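/- Let $\mathbf C$ be a category with finite limits, equipped with a wide subcategory of maps called \emph{fibrations} that is stable under pullback along arbitrary maps. For maps $k\colon K\to B$ and $p\colon B\to A$, a \emph{pushforward} of $k$ along $p$ is an object $p_*k\in\mathbf C/A$ together with bijections $\mathbf C/A\,(x,p_*k)\cong \mathbf C/B\,(p^*x,k)$ natural in $x\in \mathbf C/A$. Assume that fibrations are stable under pushforward along fibrations: for all fibrations $k\colon K\to B$ and $p\colon B\to A$, a pushforward of $k$ along $p$ exists, and every such pushforward is a fibration. Let $\mathcal I$ be a finite inverse category, i.e. a category with finitely many objects and maps for which there is a degree function $\deg\colon \operatorname{ob}\mathcal I\to\mathbb N$ such that $\deg i>\deg j$ for every non-identity map $i\to j$. For $i\in\mathcal I$ let $\partial(i/\mathcal I)$ be the full subcategory of $i/\mathcal I$ on all objects except $\mathrm{id}_i$. For $X\in\mathbf C^{\mathcal I}$ let $M_iX=\lim\bigl(\partial(i/\mathcal I)\to\mathcal I\xrightarrow{X}\mathbf C\bigr)$ be the matching object, with matching map $m_iX\colon X_i\to M_iX$ induced by the maps $X_f$. A map $p\colon E\to B$ in $\mathbf C^{\mathcal I}$ is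 a \emph{Reedy fibration} if for every $i\in\mathcal I$ the relative matching map $E_i\to B_i\times_{M_iB}M_iE$ is a fibration in $\mathbf C$. Then Reedy fibrations in $\mathbf C^{\mathcal I}$ are stable under pushforward along Reedy fibrations: for all Reedy fibrations $k\colon C\to B$ and $p\colon B\to A$ in $\mathbf C^{\mathcal I}$, a pushforward of $k$ along $p$ exists in $\mathbf C^{\mathcal I}$, and every such pushforward is a Reedy fibration. -/

import Mathlib

open CategoryTheory CategoryTheory.Limits

universe w v u

namespace InverseDiagrams

/-- A category is an *inverse category* if its objects admit a degree function to `ℕ` which is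
strictly decreased by every morphism that is not an identity. -/
class IsInverseCategory (I : Type u) [Category.{v} I] : Prop where
  exists_degree : ∃ deg : I → ℕ, ∀ ⦃i j : I⦄ (f : i ⟶ j),
    (¬ ∃ h : i = j, f = eqToHom h) → deg j < deg i

section Pushforward

variable {C : Type u} [Category.{v} C] [HasPullbacks C]

/-- `q : P ⟶ A` is a pushforward of `k : K ⟶ B` along `p : B ⟶ A`: maps `x ⟶ q` over `A` are in
bijection, naturally in `x`, with maps `p^* x ⟶ k` over `B`. -/
def IsPushforward {A B K P : C} (p : B ⟶ A) (k : K ⟶ B) (q : P ⟶ A) : Prop :=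
  Nonempty (((Over.pullback p).op ⋙ yoneda.obj (Over.mk k)).RepresentableBy (Over.mk q))

/-- A class of maps `W` is *stable under pushforward along itself*: for `k : K ⟶ B` and
`p : B ⟶ A` in `W`, a pushforward of `k` along `p` exists, and every such pushforward is
again in `W`. -/
def StableUnderPushforward (W : MorphismProperty C) : Prop :=
  ∀ ⦃A B K : C⦄ (p : B ⟶ A) (k : K ⟶ B), W p → W k →
    (∃ (P : C) (q : P ⟶ A), IsPushforward p k q) ∧
      ∀ (P : C) (q : P ⟶ A), IsPushforward p k q → W q

end Pushforward

section Matching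

variable {I : Type w} [SmallCategory I]

/-- `∂(i/I)`: the full subcategory of the under category `i/I` on all objects except the
identity map of `i`. -/
abbrev Boundary (i : I) : Type w :=
  ObjectProperty.FullSubcategory (fun f : Under i => f ≠ Under.mk (𝟙 i))

/-- The projection `∂(i/I) ⥤ I`, sending `f : i ⟶ j` to `j`. -/
abbrev Boundary.proj (i : I) : Boundary i ⥤ I :=
  ObjectProperty.ι _ ⋙ Under.forget i

/-- The boundary of an object of a finite category is a finite category. -/
noncomputable instance Boundary.finCategory [FinCategory I] (i : I) :
    FinCategory (Boundary i) where
  fintypeObj := by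
    classical
    have : Finite (Under i) := Finite.of_injective
      (β := Σ j : I, (i ⟶ j)) (fun f => ⟨f.right, f.hom⟩) (by
        rintro ⟨⟨⟨⟩⟩, j, f⟩ ⟨⟨⟨⟩⟩, j', f'⟩ h
        simp only [Sigma.mk.injEq] at h
        obtain ⟨rfl, h⟩ := h
        obtain rfl := eq_of_heq h
        rfl)
    have : Finite (Boundary i) := Finite.of_injective
      (fun f => f.obj) (by rintro ⟨a, _⟩ ⟨b, _⟩ h; cases h; rfl)
    exact Fintype.ofFinite _
  fintypeHom f g := by
    classical
    have : Finite (f ⟶ g) := Finite.of_injective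
      (fun a => (Boundary.proj i).map a) (by
        intro a b h
        exact InducedCategory.hom_ext (Under.UnderMorphism.ext h))
    exact Fintype.ofFinite _

variable {C : Type u} [Category.{v} C] [HasFiniteLimits C] [FinCategory I]

/-- The matching object `M_i X`, the limit of `∂(i/I) ⥤ I ⥤ C`. -/
noncomputable def matchingObj (X : I ⥤ C) (i : I) : C :=
  limit (Boundary.proj i ⋙ X)

/-- The limit projection `M_i X ⟶ X_j` at `f : i ⟶ j` in `∂(i/I)`. -/
noncomputable def matchingObjProj (X : I ⥤ C) (i : I) (f : Boundary i) :
    matchingObj X i ⟶ X.obj f.obj.right :=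
  limit.π (Boundary.proj i ⋙ X) f

/-- The map `M_i p : M_i X ⟶ M_i Y` induced by a map of diagrams `p : X ⟶ Y`. -/
noncomputable def matchingObjMap {X Y : I ⥤ C} (p : X ⟶ Y) (i : I) :
    matchingObj X i ⟶ matchingObj Y i :=
  limMap (Functor.whiskerLeft (Boundary.proj i) p)

/-- The cone of the maps `X_f : X_i ⟶ X_j` for `f : i ⟶ j` in `∂(i/I)`. -/
def matchingCone (X : I ⥤ C) (i : I) : Cone (Boundary.proj i ⋙ X) where
  pt := X.obj i
  π :=
    { app := fun f => X.map f.obj.hom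
      naturality := fun f g a => by simp [← X.map_comp] }

/-- The matching map `m_i X : X_i ⟶ M_i X`, induced by the cone of the maps
`X_f : X_i ⟶ X_j` for `f : i ⟶ j` in `∂(i/I)`. -/
noncomputable def matchingMap (X : I ⥤ C) (i : I) : X.obj i ⟶ matchingObj X i :=
  limit.lift (Boundary.proj i ⋙ X) (matchingCone X i)

@[simp]
theorem matchingMap_proj (X : I ⥤ C) (i : I) (f : Boundary i) :
    matchingMap X i ≫ matchingObjProj X i f = X.map f.obj.hom :=
  limit.lift_π (matchingCone X i) f

@[simp]
theorem matchingObjMap_proj {X Y : I ⥤ C} (p : X ⟶ Y) (i : I) (f : Boundary i) :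
    matchingObjMap p i ≫ matchingObjProj Y i f =
      matchingObjProj X i f ≫ p.app f.obj.right :=
  limMap_π (Functor.whiskerLeft (Boundary.proj i) p) f

/-- The matching map is natural in the diagram. -/
theorem matchingMap_naturality {X Y : I ⥤ C} (p : X ⟶ Y) (i : I) :
    p.app i ≫ matchingMap Y i = matchingMap X i ≫ matchingObjMap p i := by
  refine limit.hom_ext fun f => ?_
  change (p.app i ≫ matchingMap Y i) ≫ matchingObjProj Y i f =
    (matchingMap X i ≫ matchingObjMap p i) ≫ matchingObjProj Y i f
  rw [Category.assoc, Category.assoc, matchingMap_proj, matchingObjMap_proj,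
    ← Category.assoc, matchingMap_proj]
  exact (p.naturality f.obj.hom).symm

/-- The relative matching map `E_i ⟶ B_i ×_{M_i B} M_i E` of a map of diagrams `p : E ⟶ B`. -/
noncomputable def relativeMatchingMap {E B : I ⥤ C} (p : E ⟶ B) (i : I) :
    E.obj i ⟶ pullback (matchingMap B i) (matchingObjMap p i) :=
  pullback.lift (p.app i) (matchingMap E i) (matchingMap_naturality p i)

/-- The Reedy fibrations in `I ⥤ C` with respect to a class `F` of fibrations of `C`: the maps all
of whose relative matching maps are in `F`. -/
def reedyFibrations (F : MorphismProperty C) : MorphismProperty (I ⥤ C) :=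
  fun _ _ p => ∀ i : I, F (relativeMatchingMap p i)

end Matching

end InverseDiagrams

/-!
Let `i` be a maximal object of `I`. A diagram on `I` amounts to a diagram `W` on `I ∖ i` together
with a map from an object of `C` to the limit of `W` over `∂(i/I)`, so `I ⥤ C` is equivalent to the
comma category of `𝟭 C` and this limit functor, and the Reedy fibrations correspond to the maps
which are Reedy fibrations on `I ∖ i` and whose gap map at `i` is a fibration. In such a comma
category pushforwards are computed in two steps, first on `I ∖ i` and then, after base changes along
the gap maps, at `i`. The result follows by induction on the number of objects. The limit functor
sends Reedy fibrations to fibrations, by the same induction, because `limit X` is the pullback of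
`m_i X` along the map from the limit of `X` over `I ∖ i` to `M_i X`.
-/

namespace InverseDiagrams

section DistributivityPullback

variable {C : Type u} [Category.{v} C] {A B K P T : C}

/-- `q : P ⟶ A`, the object `T` over `P` and `ε : T ⟶ K` form a *distributivity pullback* around
`p` and `k` (Weber): `T` is the pullback of `q` along `p`, and the maps `l : X ⟶ P` over `A`
correspond to the maps `e : Y ⟶ K` over `B`, where `Y` is a pullback of `X` along `p`. This says
that `q` is a pushforward of `k` along `p` with counit `ε`, without choosing pullbacks. -/
structure IsDistributivityPullback (p : B ⟶ A) (k : K ⟶ B) (s : T ⟶ P) (ε : T ⟶ K)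
    (q : P ⟶ A) : Prop where
  isPullback : IsPullback s (ε ≫ k) q p
  existsUnique {X Y : C} {t : Y ⟶ X} {e : Y ⟶ K} {a : X ⟶ A} :
    IsPullback t (e ≫ k) a p →
      ∃! l : X ⟶ P, l ≫ q = a ∧ ∃ r : Y ⟶ T, r ≫ s = t ≫ l ∧ r ≫ ε = e

namespace IsDistributivityPullback

theorem of_iso {p : B ⟶ A} {k : K ⟶ B} {s : T ⟶ P} {ε : T ⟶ K} {q : P ⟶ A}
    (h : IsDistributivityPullback p k s ε q) {P' T' : C} (eT : T' ≅ T) (eP : P' ≅ P) :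
    IsDistributivityPullback p k (eT.hom ≫ s ≫ eP.inv) (eT.hom ≫ ε) (eP.hom ≫ q) where
  isPullback := h.isPullback.of_iso eT.symm eP.symm (Iso.refl _) (Iso.refl _) (by simp) (by simp)
    (by simp) (by simp)
  existsUnique {X Y t e a} sq := by
    obtain ⟨l, ⟨hl, r, hr, hε⟩, huniq⟩ := h.existsUnique sq
    refine ⟨l ≫ eP.inv, ⟨by simpa using hl, r ≫ eT.inv, ?_, by simpa using hε⟩, ?_⟩
    · simp [reassoc_of% hr]
    · rintro l' ⟨hl', r', hr', hε'⟩
      rw [Iso.eq_comp_inv]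
      refine huniq _ ⟨by simpa using hl', r' ≫ eT.hom, ?_, by simpa using hε'⟩
      simpa using congr($hr' ≫ eP.hom)

theorem of_map {D : Type*} [Category* D] (G : C ⥤ D) [G.Full] [G.Faithful]
    [PreservesLimitsOfShape WalkingCospan G] {p : B ⟶ A} {k : K ⟶ B} {s : T ⟶ P} {ε : T ⟶ K}
    {q : P ⟶ A}
    (h : IsDistributivityPullback (G.map p) (G.map k) (G.map s) (G.map ε) (G.map q)) :
    IsDistributivityPullback p k s ε q where
  isPullback := by
    have sq := h.isPullback
    rw [← G.map_comp] at sq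
    exact sq.of_map G (G.map_injective (by simpa using sq.w))
  existsUnique {X Y t e a} sq := by
    have sq' := sq.map G
    rw [G.map_comp] at sq'
    obtain ⟨l, ⟨hl, r, hr, hε⟩, huniq⟩ := h.existsUnique sq'
    obtain ⟨l, rfl⟩ := G.map_surjective l
    obtain ⟨r, rfl⟩ := G.map_surjective r
    simp only [← G.map_comp] at hl hr hε
    refine ⟨l, ⟨G.map_injective hl, r, G.map_injective hr, G.map_injective hε⟩, ?_⟩
    rintro l' ⟨hl', r', hr', hε'⟩
    refine G.map_injective (huniq _ ⟨?_, G.map r', ?_, ?_⟩)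
    · rw [← G.map_comp, hl']
    · rw [← G.map_comp, hr', G.map_comp]
    · rw [← G.map_comp, hε']

theorem of_isIso (p : B ⟶ A) [IsIso p] (k : K ⟶ B) :
    IsDistributivityPullback p k (𝟙 K) (𝟙 K) (k ≫ p) where
  isPullback := by
    have : IsPullback (𝟙 K) k (k ≫ p) p := IsPullback.of_horiz_isIso_mono ⟨by simp⟩
    simpa using this
  existsUnique {X Y t e a} sq := by
    have : IsIso t := sq.isIso_fst_of_isIso
    refine ⟨inv t ≫ e, ⟨by simpa using sq.w.symm, e, by simp, by simp⟩, ?_⟩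
    rintro l ⟨-, r, hr, rfl⟩
    simpa using congr(inv t ≫ $hr).symm

end IsDistributivityPullback

variable [HasPullbacks C]

theorem isPushforward_iff_exists_bijective {p : B ⟶ A} {k : K ⟶ B} {q : P ⟶ A} :
    IsPushforward p k q ↔ ∃ ε : (Over.pullback p).obj (Over.mk q) ⟶ Over.mk k, ∀ a : Over A,
      Function.Bijective fun l : a ⟶ Over.mk q => (Over.pullback p).map l ≫ ε := by
  constructor
  · rintro ⟨R⟩
    refine ⟨R.homEquiv (𝟙 _), fun a => ?_⟩
    have h : (fun l : a ⟶ Over.mk q => (Over.pullback p).map l ≫ R.homEquiv (𝟙 _)) =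
        R.homEquiv := funext fun l => (R.homEquiv_eq l).symm
    exact h ▸ R.homEquiv.bijective
  · rintro ⟨ε, h⟩
    exact ⟨{ homEquiv := Equiv.ofBijective _ (h _), homEquiv_comp := by simp }⟩

theorem pullback_map_comp_eq_iff {p : B ⟶ A} {k : K ⟶ B} {x y : Over A} (l : x ⟶ y)
    (ε : (Over.pullback p).obj y ⟶ Over.mk k) (e : (Over.pullback p).obj x ⟶ Over.mk k) :
    (Over.pullback p).map l ≫ ε = e ↔
      ∃ r : pullback x.hom p ⟶ pullback y.hom p,
        r ≫ pullback.fst y.hom p = pullback.fst x.hom p ≫ l.left ∧ r ≫ ε.left = e.left := by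
  have hfst : ((Over.pullback p).map l).left ≫ pullback.fst y.hom p =
      pullback.fst x.hom p ≫ l.left := pullback.lift_fst _ _ _
  have hsnd : ((Over.pullback p).map l).left ≫ pullback.snd y.hom p =
      pullback.snd x.hom p := pullback.lift_snd _ _ _
  have hε : ε.left ≫ k = pullback.snd y.hom p := Over.w ε
  have he : e.left ≫ k = pullback.snd x.hom p := Over.w e
  constructor
  · rintro rfl
    exact ⟨((Over.pullback p).map l).left, hfst, rfl⟩
  · rintro ⟨r, hr, hrε⟩
    obtain rfl : r = ((Over.pullback p).map l).left :=
      pullback.hom_ext (hr.trans hfst.symm) (by rw [hsnd, ← hε, reassoc_of% hrε, he])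
    exact Over.OverMorphism.ext hrε

theorem isPushforward_iff_exists_isDistributivityPullback {p : B ⟶ A} {k : K ⟶ B} {q : P ⟶ A} :
    IsPushforward p k q ↔
      ∃ (T : C) (s : T ⟶ P) (ε : T ⟶ K), IsDistributivityPullback p k s ε q := by
  simp only [isPushforward_iff_exists_bijective, Function.bijective_iff_existsUnique,
    pullback_map_comp_eq_iff]
  constructor
  · rintro ⟨ε, h⟩
    have hε : ε.left ≫ k = pullback.snd q p := Over.w ε
    refine ⟨_, pullback.fst q p, ε.left, hε ▸ IsPullback.of_hasPullback q p, ?_⟩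
    intro X Y t e a sq
    let φ := sq.isoPullback
    obtain ⟨l, ⟨r, hr, he⟩, huniq⟩ :=
      h (Over.mk a) (Over.homMk (φ.inv ≫ e) (by simp [φ]))
    refine ⟨l.left, ⟨Over.w l, φ.hom ≫ r, ?_, ?_⟩, ?_⟩
    · simpa [φ] using congr(φ.hom ≫ $hr)
    · simpa using congr(φ.hom ≫ $he)
    · rintro l' ⟨hl', r', hr', he'⟩
      refine congr(CommaMorphism.left $(huniq (Over.homMk l' hl') ⟨φ.inv ≫ r', ?_, ?_⟩))
      · simp [hr', φ]
      · simp [he']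
  · rintro ⟨T, s, ε, h⟩
    let ψ := h.isPullback.isoPullback
    have h' := h.of_iso ψ.symm (Iso.refl P)
    refine ⟨Over.homMk (ψ.inv ≫ ε) (by simp [ψ]), fun a e => ?_⟩
    have he : e.left ≫ k = pullback.snd a.hom p := Over.w e
    obtain ⟨l, ⟨hl, r, hr, hε⟩, huniq⟩ :=
      h'.existsUnique (he ▸ IsPullback.of_hasPullback a.hom p)
    refine ⟨Over.homMk l (by simpa using hl), ⟨r, ?_, hε⟩, ?_⟩
    · simpa [ψ] using hr
    · rintro l' ⟨r', hr', he'⟩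
      refine Over.OverMorphism.ext (huniq _ ⟨by simpa using Over.w l', r', ?_, he'⟩)
      simpa [ψ] using hr'

theorem stableUnderPushforward_iff_exists_isDistributivityPullback {W : MorphismProperty C}
    [W.RespectsIso] :
    StableUnderPushforward W ↔ ∀ ⦃A B K : C⦄ (p : B ⟶ A) (k : K ⟶ B), W p → W k →
      ∃ (P T : C) (s : T ⟶ P) (ε : T ⟶ K) (q : P ⟶ A),
        W q ∧ IsDistributivityPullback p k s ε q := by
  constructor
  · intro h A B K p k hp hk
    obtain ⟨⟨P, q, hq⟩, hW⟩ := h p k hp hk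
    obtain ⟨T, s, ε, hd⟩ := isPushforward_iff_exists_isDistributivityPullback.mp hq
    exact ⟨P, T, s, ε, q, hW P q hq, hd⟩
  · intro h A B K p k hp hk
    obtain ⟨P, T, s, ε, q, hW, hd⟩ := h p k hp hk
    have hq : IsPushforward p k q :=
      isPushforward_iff_exists_isDistributivityPullback.mpr ⟨T, s, ε, hd⟩
    refine ⟨⟨P, q, hq⟩, ?_⟩
    rintro P' q' ⟨R'⟩
    obtain ⟨R⟩ := hq
    let e : Over.mk q ≅ Over.mk q' := R.uniqueUpToIso R'
    exact (W.arrow_mk_iso_iff (Arrow.isoMk ((Over.forget A).mapIso e) (Iso.refl A)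
      (by simpa using Over.w e.hom))).mp hW

theorem StableUnderPushforward.inverseImage {D : Type*} [Category* D] [HasPullbacks D]
    {W : MorphismProperty D} [W.RespectsIso] (h : StableUnderPushforward W) (G : C ⥤ D)
    [G.IsEquivalence] : StableUnderPushforward (W.inverseImage G) := by
  rw [stableUnderPushforward_iff_exists_isDistributivityPullback] at h ⊢
  intro A B K p k hp hk
  obtain ⟨P, T, s, ε, q, hW, hd⟩ := h _ _ hp hk
  have hd' := hd.of_iso (G.objObjPreimageIso T) (G.objObjPreimageIso P)
  refine ⟨_, _, G.preimage _, G.preimage _, G.preimage ((G.objObjPreimageIso P).hom ≫ q), ?_,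
    .of_map G (by simpa only [G.map_preimage] using hd')⟩
  simpa [MorphismProperty.inverseImage_iff] using (W.cancel_left_of_respectsIso _ q).mpr hW

end DistributivityPullback

section GapMaps

variable {C : Type u} [Category.{v} C] [HasPullbacks C]

theorem comp_pullbackLift_eq_comp_pullbackLift_iff {V W W' X Y Z : C} {f : X ⟶ Z} {g : Y ⟶ Z}
    {a : W ⟶ X} {b : W ⟶ Y} {a' : W' ⟶ X} {b' : W' ⟶ Y} (h : a ≫ f = b ≫ g)
    (h' : a' ≫ f = b' ≫ g) (c : V ⟶ W) (c' : V ⟶ W') :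
    c ≫ pullback.lift a b h = c' ≫ pullback.lift a' b' h' ↔ c ≫ a = c' ≫ a' ∧ c ≫ b = c' ≫ b' := by
  refine ⟨fun w => ⟨?_, ?_⟩, fun ⟨w₁, w₂⟩ => pullback.hom_ext ?_ ?_⟩
  · simpa only [Category.assoc, pullback.lift_fst] using congr($w ≫ pullback.fst f g)
  · simpa only [Category.assoc, pullback.lift_snd] using congr($w ≫ pullback.snd f g)
  · simpa only [Category.assoc, pullback.lift_fst] using w₁
  · simpa only [Category.assoc, pullback.lift_snd] using w₂

variable (F : MorphismProperty C)

theorem pullbackLift_mem_iff [F.RespectsIso] {W X Y Z P : C} {f : X ⟶ Z} {g : Y ⟶ Z}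
    {fst : P ⟶ X} {snd : P ⟶ Y} (sq : IsPullback fst snd f g) {a : W ⟶ X} {b : W ⟶ Y}
    (h : a ≫ f = b ≫ g) (u : W ⟶ P) (ha : u ≫ fst = a) (hb : u ≫ snd = b) :
    F (pullback.lift a b h) ↔ F u := by
  have hu : pullback.lift a b h = u ≫ sq.isoPullback.hom :=
    pullback.hom_ext
      (by rw [pullback.lift_fst, Category.assoc, sq.isoPullback_hom_fst, ha])
      (by rw [pullback.lift_snd, Category.assoc, sq.isoPullback_hom_snd, hb])
  rw [hu, F.cancel_right_of_respectsIso]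

theorem mem_of_pullbackLift_mem [F.IsStableUnderComposition] [F.IsStableUnderBaseChange]
    {W X Y Z : C} {f : X ⟶ Z} {g : Y ⟶ Z} {a : W ⟶ X} {b : W ⟶ Y} {h : a ≫ f = b ≫ g}
    (hF : F (pullback.lift a b h)) (hg : F g) : F a := by
  rw [← pullback.lift_fst a b h]
  exact F.comp_mem _ _ hF (F.pullback_fst _ _ hg)

/-- If `E` and `B` are the pullbacks of `E₁ ⟶ Eₘ ⟵ E₀` and `B₁ ⟶ Bₘ ⟵ B₀`, then `E ⟶ B` factors
as a base change of the gap map `E₁ ⟶ B₁ ×[Bₘ] Eₘ` followed by a base change of `E₀ ⟶ B₀`. -/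
theorem mem_of_isPullback_of_pullbackLift_mem [F.IsStableUnderComposition]
    [F.IsStableUnderBaseChange] {E E₁ E₀ Eₘ B B₁ B₀ Bₘ : C}
    {e₁ : E ⟶ E₁} {e₀ : E ⟶ E₀} {m₁ : E₁ ⟶ Eₘ} {m₀ : E₀ ⟶ Eₘ}
    {b₁ : B ⟶ B₁} {b₀ : B ⟶ B₀} {n₁ : B₁ ⟶ Bₘ} {n₀ : B₀ ⟶ Bₘ}
    {p : E ⟶ B} {p₁ : E₁ ⟶ B₁} {p₀ : E₀ ⟶ B₀} {pₘ : Eₘ ⟶ Bₘ}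
    (sqE : IsPullback e₁ e₀ m₁ m₀) (sqB : IsPullback b₁ b₀ n₁ n₀)
    (h₁ : p ≫ b₁ = e₁ ≫ p₁) (h₀ : p ≫ b₀ = e₀ ≫ p₀)
    {w₁ : p₁ ≫ n₁ = m₁ ≫ pₘ} (w₀ : p₀ ≫ n₀ = m₀ ≫ pₘ)
    (hgap : F (pullback.lift p₁ m₁ w₁)) (hp₀ : F p₀) : F p := by
  let z : pullback b₀ p₀ ⟶ pullback n₁ pₘ :=
    pullback.map _ _ _ _ b₁ m₀ n₀ sqB.w.symm w₀
  have hz₁ : z ≫ pullback.fst n₁ pₘ = pullback.fst b₀ p₀ ≫ b₁ := pullback.lift_fst _ _ _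
  have hzₘ : z ≫ pullback.snd n₁ pₘ = pullback.snd b₀ p₀ ≫ m₀ := pullback.lift_snd _ _ _
  have sqz : IsPullback z (pullback.snd b₀ p₀) (pullback.snd n₁ pₘ) m₀ := by
    have outer := (IsPullback.of_hasPullback b₀ p₀).paste_horiz sqB
    rw [← hz₁, w₀] at outer
    exact outer.of_right hzₘ (IsPullback.of_hasPullback n₁ pₘ)
  have sqgap : IsPullback e₁ (pullback.lift p e₀ h₀) (pullback.lift p₁ m₁ w₁) z := by
    refine IsPullback.of_bot (by simpa only [pullback.lift_snd] using sqE) ?_ sqz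
    apply pullback.hom_ext
    · rw [Category.assoc, Category.assoc, hz₁, pullback.lift_fst, pullback.lift_fst_assoc, h₁]
    · rw [Category.assoc, Category.assoc, hzₘ, pullback.lift_snd, pullback.lift_snd_assoc, sqE.w]
  rw [← pullback.lift_fst p e₀ h₀]
  exact F.comp_mem _ _ (F.of_isPullback sqgap hgap) (F.pullback_fst _ _ hp₀)

end GapMaps

section Gluing

variable {C : Type*} [Category* C] {D : Type*} [Category* D] {G : D ⥤ C}

section Pullbacks

variable {J : Type*} [Category* J] [HasLimitsOfShape J C] [HasLimitsOfShape J D]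
  [PreservesLimitsOfShape J G]

instance preservesLimitsOfShape_comma_fst : PreservesLimitsOfShape J (Comma.fst (𝟭 C) G) where
  preservesLimit := preservesLimit_of_preserves_limit_cone
    (Comma.coneOfPreservesIsLimit _ (limit.isLimit _) (limit.isLimit _)) (limit.isLimit _)

instance preservesLimitsOfShape_comma_snd : PreservesLimitsOfShape J (Comma.snd (𝟭 C) G) where
  preservesLimit := preservesLimit_of_preserves_limit_cone
    (Comma.coneOfPreservesIsLimit _ (limit.isLimit _) (limit.isLimit _)) (limit.isLimit _)

end Pullbacks

theorem isPullback_of_isPullback_left_of_isPullback_right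
    [PreservesLimitsOfShape WalkingCospan G] {W X Y Z : Comma (𝟭 C) G}
    {f : W ⟶ X} {g : W ⟶ Y} {h : X ⟶ Z} {k : Y ⟶ Z}
    (hl : IsPullback f.left g.left h.left k.left)
    (hr : IsPullback f.right g.right h.right k.right) : IsPullback f g h k := by
  have w : f ≫ h = g ≫ k := Comma.hom_ext _ _ hl.w hr.w
  refine ⟨⟨w⟩, ⟨Comma.fstSndJointlyReflectLimit ?_ ?_⟩⟩
  · exact (isLimitMapConePullbackConeEquiv (Comma.fst (𝟭 C) G) w).symm hl.isLimit
  · exact (isLimitMapConePullbackConeEquiv (Comma.snd (𝟭 C) G) w).symm hr.isLimit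

section Construction

variable [HasPullbacks C] [PreservesLimitsOfShape WalkingCospan G] {A B K P T : Comma (𝟭 C) G}
  {p : B ⟶ A} {k : K ⟶ B} {s : T ⟶ P} {ε : T ⟶ K} {q : P ⟶ A} {D₁ D'₁ N : C}
  {d : D₁ ⟶ A.left} {d₀ : D₁ ⟶ G.obj P.right} {e : D'₁ ⟶ D₁} {b : D'₁ ⟶ B.left}
  {t : D'₁ ⟶ G.obj T.right} {n : N ⟶ D'₁} {c : N ⟶ K.left}

/-- Once the right hand components `l` and `r` of a solution to the pushforward problem
`(f, g, a)` are found, its left hand components are a solution to the problem `(f.left, v, x)` for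
the pushforward of `n` along `e`. -/
theorem exists_isPullback_left
    (right : IsPullback s.right (ε.right ≫ k.right) q.right p.right)
    (sqD' : IsPullback b e p.left d) (hts : t ≫ G.map s.right = e ≫ d₀)
    (htb : t ≫ G.map ε.right ≫ G.map k.right = b ≫ B.hom)
    {hk : k.left ≫ B.hom = K.hom ≫ G.map k.right}
    (sqN : IsPullback c n (pullback.lift k.left K.hom hk)
      (pullback.lift b (t ≫ G.map ε.right) (by simp [htb])))
    {X Y : Comma (𝟭 C) G} {f : Y ⟶ X} {g : Y ⟶ K} {a : X ⟶ A}
    (left : IsPullback f.left (g.left ≫ k.left) a.left p.left)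
    {l : X.right ⟶ P.right} {r : Y.right ⟶ T.right} (hrs : r ≫ s.right = f.right ≫ l)
    (hrε : r ≫ ε.right = g.right) {x : X.left ⟶ D₁} (hxd : x ≫ d = a.left)
    (hxd₀ : x ≫ d₀ = X.hom ≫ G.map l) :
    ∃ v : Y.left ⟶ N, v ≫ c = g.left ∧ v ≫ n ≫ t = Y.hom ≫ G.map r ∧
      IsPullback f.left (v ≫ n) x e := by
  have hf : f.left ≫ X.hom = Y.hom ≫ G.map f.right := f.w
  have hg : g.left ≫ K.hom = Y.hom ≫ G.map g.right := g.w
  obtain ⟨y, hyb, hye⟩ := sqD'.exists_lift (g.left ≫ k.left) (f.left ≫ x)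
    (by rw [← left.w, Category.assoc, hxd])
  have hyt : y ≫ t = Y.hom ≫ G.map r := by
    refine (right.map G).hom_ext ?_ ?_
    · rw [Category.assoc, hts, reassoc_of% hye, hxd₀, reassoc_of% hf, Category.assoc,
        ← G.map_comp, ← G.map_comp, hrs]
    · rw [Category.assoc, G.map_comp, htb, reassoc_of% hyb, hk, reassoc_of% hg, Category.assoc,
        ← hrε, G.map_comp_assoc]
  obtain ⟨v, hvc, hvn⟩ := sqN.exists_lift g.left y <|
    (comp_pullbackLift_eq_comp_pullbackLift_iff ..).mpr
      ⟨hyb.symm, by rw [reassoc_of% hyt, hg, ← hrε, G.map_comp]⟩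
  subst hvn
  refine ⟨v, hvc, by simpa using hyt, ?_⟩
  rw [← hyb, ← hxd] at left
  exact (left.flip.of_right hye sqD').flip

/-- Given the right hand components of a distributivity pullback in `Comma (𝟭 C) G`, the left
hand components are obtained from the pushforward, along the base change `D'₁ ⟶ D₁` of `p.left` to
`D₁ = A.left ×[G A.right] G P.right`, of the base change `N ⟶ D'₁` of the gap map of `k`. -/
theorem IsDistributivityPullback.comma [HasPullbacks D]
    (right : IsDistributivityPullback p.right k.right s.right ε.right q.right)
    (sqD : IsPullback d d₀ A.hom (G.map q.right)) (sqD' : IsPullback b e p.left d)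
    (hts : t ≫ G.map s.right = e ≫ d₀)
    (htb : t ≫ G.map ε.right ≫ G.map k.right = b ≫ B.hom)
    {hk : k.left ≫ B.hom = K.hom ≫ G.map k.right}
    (sqN : IsPullback c n (pullback.lift k.left K.hom hk)
      (pullback.lift b (t ≫ G.map ε.right) (by simp [htb])))
    {η : T.left ⟶ N} {u : P.left ⟶ D₁} (left : IsDistributivityPullback e n s.left η u)
    (hud : u ≫ d = q.left) (hud₀ : u ≫ d₀ = P.hom) (hηc : η ≫ c = ε.left)
    (hηt : η ≫ n ≫ t = T.hom) :
    IsDistributivityPullback p k s ε q := by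
  have hcb : n ≫ b = c ≫ k.left :=
    ((comp_pullbackLift_eq_comp_pullbackLift_iff ..).mp sqN.w).1.symm
  have hηb : η ≫ n ≫ b = ε.left ≫ k.left := by rw [hcb, reassoc_of% hηc]
  constructor
  · refine isPullback_of_isPullback_left_of_isPullback_right ?_ right.isPullback
    simpa [hud, hηb] using (left.isPullback.flip.paste_horiz sqD').flip
  · intro X Y f g a sq
    have sql : IsPullback f.left (g.left ≫ k.left) a.left p.left := sq.map (Comma.fst (𝟭 C) G)
    have sqr : IsPullback f.right (g.right ≫ k.right) a.right p.right :=
      sq.map (Comma.snd (𝟭 C) G)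
    have ha : a.left ≫ A.hom = X.hom ≫ G.map a.right := a.w
    obtain ⟨l₀, ⟨hl₀, r₀, hrs₀, hrε₀⟩, huniq₀⟩ := right.existsUnique sqr
    obtain ⟨x, hxd, hxd₀⟩ := sqD.exists_lift a.left (X.hom ≫ G.map l₀)
      (by rw [ha, ← hl₀, G.map_comp, Category.assoc])
    obtain ⟨v, hvc, hvt, sqv⟩ := exists_isPullback_left right.isPullback sqD' hts htb sqN sql
      hrs₀ hrε₀ hxd hxd₀
    obtain ⟨l₁, ⟨hl₁, r₁, hrs₁, hrη₁⟩, huniq₁⟩ := left.existsUnique sqv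
    let l : X ⟶ P := { left := l₁, right := l₀, w := by simp [← hud₀, reassoc_of% hl₁, hxd₀] }
    let r : Y ⟶ T := { left := r₁, right := r₀, w := by simp [← hηt, reassoc_of% hrη₁, hvt] }
    refine ⟨l, ⟨?_, r, ?_, ?_⟩, ?_⟩
    · exact Comma.hom_ext _ _ (by simp [l, ← hud, reassoc_of% hl₁, hxd]) hl₀
    · exact Comma.hom_ext _ _ hrs₁ hrs₀
    · exact Comma.hom_ext _ _ (by simp [r, ← hηc, reassoc_of% hrη₁, hvc]) hrε₀
    · rintro l' ⟨rfl, r', hrs', rfl⟩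
      have hl'₀ : l'.right = l₀ :=
        huniq₀ _ ⟨rfl, r'.right, congr(CommaMorphism.right $hrs'), rfl⟩
      have hl'₁ : l'.left ≫ u = x := sqD.hom_ext (by simpa [hud] using hxd.symm)
        (by rw [Category.assoc, hud₀, hxd₀, ← hl'₀]; exact l'.w)
      have hrs'₁ : r'.left ≫ s.left = f.left ≫ l'.left := congr(CommaMorphism.left $hrs')
      refine Comma.hom_ext _ _ (huniq₁ _ ⟨hl'₁, r'.left, hrs'₁, ?_⟩) hl'₀
      refine sqN.hom_ext (by simp [hηc, hvc]) (sqD'.hom_ext ?_ ?_)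
      · simp [hcb, reassoc_of% hvc, reassoc_of% hηc]
      · have := left.isPullback.w
        simp only [Category.assoc] at this ⊢
        rw [← this, reassoc_of% hrs'₁, hl'₁, sqv.w, Category.assoc]

end Construction

section GluedFibrations

variable [HasPullbacks C] (F : MorphismProperty C) (W : MorphismProperty D)

/-- The maps `f : X ⟶ Y` in the comma category of `𝟭 C` and `G` whose gap map
`X.left ⟶ Y.left ×[G Y.right] G X.right` is in `F`. -/
def gapFibrations : MorphismProperty (Comma (𝟭 C) G) :=
  fun X _ f => F (pullback.lift (f := Comma.hom _) (g := G.map f.right) f.left X.hom f.w)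

instance [F.RespectsIso] : (gapFibrations F : MorphismProperty (Comma (𝟭 C) G)).RespectsIso := by
  refine MorphismProperty.RespectsIso.mk _ ?_ ?_
  · intro X Y Z i f hf
    let e : G.obj X.right ≅ G.obj Y.right := G.mapIso ((Comma.snd (𝟭 C) G).mapIso i)
    have he : G.map i.hom.right = e.hom := rfl
    have sq : IsPullback (pullback.fst Z.hom (G.map f.right))
        (pullback.snd Z.hom (G.map f.right) ≫ e.inv) Z.hom
        (G.map (i.hom ≫ f).right) :=
      (IsPullback.of_hasPullback _ _).of_iso (Iso.refl _) (Iso.refl _) e.symm (Iso.refl _)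
        (by simp) (by simp) (by simp) (by simp [he])
    refine (pullbackLift_mem_iff F sq _ (i.hom.left ≫ _) ?_ ?_).mpr
      ((F.cancel_left_of_respectsIso i.hom.left _).mpr hf)
    · rw [Category.assoc, pullback.lift_fst, Comma.comp_left]
    · rw [Category.assoc, pullback.lift_snd_assoc, ← Category.assoc, Iso.comp_inv_eq, ← he]
      exact i.hom.w
  · intro X Y Z i f hf
    have sq : IsPullback (pullback.fst Y.hom (G.map f.right) ≫ i.hom.left)
        (pullback.snd Y.hom (G.map f.right)) Z.hom (G.map (f ≫ i.hom).right) :=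
      (IsPullback.of_hasPullback _ _).of_iso (Iso.refl _) ((Comma.fst _ _).mapIso i) (Iso.refl _)
        (G.mapIso ((Comma.snd _ _).mapIso i)) (by simp) (by simp) i.hom.w.symm (by simp)
    refine (pullbackLift_mem_iff F sq _ _ ?_ ?_).mpr hf
    · rw [pullback.lift_fst_assoc, Comma.comp_left]
    · rw [pullback.lift_snd]

/-- The maps of the comma category of `𝟭 C` and `G` with right hand component in `W` and gap map
in `F`. -/
def gluedFibrations : MorphismProperty (Comma (𝟭 C) G) :=
  W.inverseImage (Comma.snd (𝟭 C) G) ⊓ gapFibrations F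

instance [F.RespectsIso] [W.RespectsIso] :
    (gluedFibrations F W : MorphismProperty (Comma (𝟭 C) G)).RespectsIso := by
  unfold gluedFibrations; infer_instance

variable {F W}

theorem StableUnderPushforward.gluedFibrations [HasPullbacks D]
    [PreservesLimitsOfShape WalkingCospan G] [F.IsStableUnderComposition]
    [F.IsStableUnderBaseChange] [W.RespectsIso] (hF : StableUnderPushforward F)
    (hW : StableUnderPushforward W) (hG : W ≤ F.inverseImage G) :
    StableUnderPushforward (gluedFibrations F W : MorphismProperty (Comma (𝟭 C) G)) := by
  rw [stableUnderPushforward_iff_exists_isDistributivityPullback] at hF hW ⊢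
  rintro A B K p k ⟨hp₀, hp₁⟩ ⟨hk₀, hk₁⟩
  have hpw : p.left ≫ A.hom = B.hom ≫ G.map p.right := p.w
  have hkw : k.left ≫ B.hom = K.hom ≫ G.map k.right := k.w
  have hp : F p.left := mem_of_pullbackLift_mem F hp₁ (hG _ hp₀)
  obtain ⟨P₀, T₀, s₀, ε₀, q₀, hq₀, right⟩ := hW p.right k.right hp₀ hk₀
  obtain ⟨D₁, d, d₀, sqD⟩ : ∃ (D₁ : C) (d : D₁ ⟶ A.left) (d₀ : D₁ ⟶ G.obj P₀),
      IsPullback d d₀ A.hom (G.map q₀) := ⟨_, _, _, .of_hasPullback _ _⟩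
  obtain ⟨D'₁, b, e, sqD'⟩ : ∃ (D'₁ : C) (b : D'₁ ⟶ B.left) (e : D'₁ ⟶ D₁),
      IsPullback b e p.left d := ⟨_, _, _, .of_hasPullback _ _⟩
  obtain ⟨t, hts, htb⟩ := (right.isPullback.map G).exists_lift (e ≫ d₀) (b ≫ B.hom)
    (by rw [Category.assoc, ← sqD.w, ← reassoc_of% sqD'.w, hpw, Category.assoc])
  rw [G.map_comp] at htb
  obtain ⟨N, c, n, sqN⟩ : ∃ (N : C) (c : N ⟶ K.left) (n : N ⟶ D'₁),
      IsPullback c n (pullback.lift k.left K.hom hkw)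
        (pullback.lift b (t ≫ G.map ε₀) (by simp [htb])) := ⟨_, _, _, .of_hasPullback _ _⟩
  have hcK : c ≫ K.hom = n ≫ t ≫ G.map ε₀ :=
    ((comp_pullbackLift_eq_comp_pullbackLift_iff ..).mp sqN.w).2
  obtain ⟨P₁, T₁, s₁, η, u, hu, left⟩ :=
    hF e n (F.of_isPullback sqD' hp) (F.of_isPullback sqN hk₁)
  let P : Comma (𝟭 C) G := { left := P₁, right := P₀, hom := u ≫ d₀ }
  let T : Comma (𝟭 C) G := { left := T₁, right := T₀, hom := η ≫ n ≫ t }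
  let q : P ⟶ A := { left := u ≫ d, right := q₀, w := by simp [P, sqD.w] }
  let s : T ⟶ P :=
    { left := s₁, right := s₀, w := by simp [P, T, hts, reassoc_of% left.isPullback.w] }
  let ε : T ⟶ K :=
    { left := η ≫ c, right := ε₀, w := by simp [T, hcK] }
  exact ⟨P, T, s, ε, q, ⟨hq₀, (pullbackLift_mem_iff F sqD _ u rfl rfl).mpr hu⟩,
    .comma right sqD sqD' hts htb sqN left rfl rfl rfl rfl⟩

end GluedFibrations

end Gluing

section InverseCategory

variable {I : Type*} [Category* I]

/-- An object `i` is *maximal* if the only map with codomain `i` is its identity. -/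
def IsMaximal (i : I) : Prop :=
  ∀ ⦃j : I⦄ (f : j ⟶ i), ∃ h : j = i, f = eqToHom h

theorem IsMaximal.eq {i j : I} (hi : IsMaximal i) (f : j ⟶ i) : j = i :=
  (hi f).1

namespace IsInverseCategory

variable [IsInverseCategory I]

theorem exists_eqToHom_of_hom_of_hom {i j : I} (f : i ⟶ j) (g : j ⟶ i) :
    ∃ h : i = j, f = eqToHom h := by
  obtain ⟨deg, hdeg⟩ := exists_degree (I := I)
  by_contra hf
  have hij := hdeg f hf
  by_cases hg : ∃ h : j = i, g = eqToHom h
  · obtain ⟨rfl, -⟩ := hg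
    exact hij.false
  · exact hij.asymm (hdeg g hg)

theorem eq_mk_id_iff_isIso {i : I} (f : Under i) : f = Under.mk (𝟙 i) ↔ IsIso f.hom := by
  constructor
  · rintro rfl
    exact inferInstanceAs (IsIso (𝟙 i))
  · intro hf
    obtain ⟨h, hf'⟩ := exists_eqToHom_of_hom_of_hom f.hom (inv f.hom)
    obtain ⟨⟨⟨⟩⟩, j, g⟩ := f
    obtain rfl : i = j := h
    exact congrArg Under.mk hf'

variable (I) in
theorem exists_isMaximal [Finite I] [Nonempty I] : ∃ i : I, IsMaximal i := by
  obtain ⟨deg, hdeg⟩ := exists_degree (I := I)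
  obtain ⟨i, hi⟩ := Finite.exists_max deg
  exact ⟨i, fun j f => by_contra fun hf => (hdeg f hf).not_ge (hi j)⟩

instance (P : ObjectProperty I) : IsInverseCategory P.FullSubcategory := by
  obtain ⟨deg, hdeg⟩ := exists_degree (I := I)
  refine ⟨fun j => deg j.obj, fun a b f hf => hdeg f.hom ?_⟩
  rintro ⟨h, hf'⟩
  obtain rfl := ObjectProperty.FullSubcategory.ext h
  exact hf ⟨rfl, ObjectProperty.hom_ext _ hf'⟩

instance (i : I) : IsInverseCategory (Under i) := by
  obtain ⟨deg, hdeg⟩ := exists_degree (I := I)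
  refine ⟨fun j => deg j.right, fun a b f hf => hdeg f.right ?_⟩
  rintro ⟨h, hf'⟩
  obtain rfl : a = b := by
    have hw := Under.w f
    obtain ⟨⟨⟨⟩⟩, j, x⟩ := a
    obtain ⟨⟨⟨⟩⟩, k, y⟩ := b
    obtain rfl : j = k := h
    rw [hf', eqToHom_refl, Category.comp_id] at hw
    exact congrArg Under.mk hw
  exact hf ⟨rfl, Under.UnderMorphism.ext hf'⟩

end IsInverseCategory

/-- The full subcategory on all objects other than `i`. -/
abbrev Complement (i : I) : Type _ :=
  ObjectProperty.FullSubcategory fun j : I => j ≠ i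

/-- The inclusion of the complement of an object. -/
abbrev Complement.ι (i : I) : Complement i ⥤ I :=
  ObjectProperty.ι _

end InverseCategory

section Induction

noncomputable instance {I : Type w} [SmallCategory I] [FinCategory I] (i : I) :
    FinCategory (Complement i) where
  fintypeObj :=
    have := Finite.of_injective (fun j : Complement i => j.obj)
      fun _ _ => ObjectProperty.FullSubcategory.ext
    Fintype.ofFinite _
  fintypeHom j k :=
    have := Finite.of_injective (fun f : j ⟶ k => f.hom) fun _ _ => ObjectProperty.hom_ext _
    Fintype.ofFinite _

theorem IsInverseCategory.induction
    {motive : ∀ (I : Type w) [SmallCategory I] [FinCategory I] [IsInverseCategory I], Prop}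
    (of_isEmpty : ∀ (I : Type w) [SmallCategory I] [FinCategory I] [IsInverseCategory I]
      [IsEmpty I], motive I)
    (of_complement : ∀ (I : Type w) [SmallCategory I] [FinCategory I] [IsInverseCategory I]
      (i : I), IsMaximal i → motive (Complement i) → motive I)
    (I : Type w) [SmallCategory I] [FinCategory I] [IsInverseCategory I] : motive I := by
  induction hn : Nat.card I using Nat.strong_induction_on generalizing I with
  | _ n ih =>
    subst hn
    cases isEmpty_or_nonempty I
    · exact of_isEmpty I
    · obtain ⟨i, hi⟩ := exists_isMaximal I
      refine of_complement I i hi (ih _ ?_ (Complement i) rfl)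
      simp only [Nat.card_eq_fintype_card]
      exact Fintype.card_lt_of_injective_of_notMem (fun j : Complement i => j.obj)
        (fun _ _ => ObjectProperty.FullSubcategory.ext) (b := i)
        (by rintro ⟨j, h⟩; exact j.property h)

end Induction

section CosliceEquivalence

/-- A functor `φ : J ⥤ I` is a *coslice equivalence* if `j/J ⥤ φ(j)/I` is an equivalence for every
`j`. Restriction of diagrams along such functors does not change matching objects. -/
class IsCosliceEquivalence {J I : Type*} [Category* J] [Category* I] (φ : J ⥤ I) : Prop where
  isEquivalence_post (j : J) : (Under.post (X := j) φ).IsEquivalence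

attribute [instance] IsCosliceEquivalence.isEquivalence_post

theorem IsMaximal.isCosliceEquivalence_ι {I : Type*} [Category* I] {i : I} (hi : IsMaximal i) :
    IsCosliceEquivalence (Complement.ι i) where
  isEquivalence_post j :=
    { essSurj := ⟨fun f => by
        have hf : f.right ≠ i := by
          intro h
          exact j.property (hi.eq (f.hom ≫ eqToHom h))
        exact ⟨Under.mk (ObjectProperty.homMk f.hom : j ⟶ ⟨f.right, hf⟩),
          ⟨Under.isoMk (Iso.refl _) (Category.comp_id _)⟩⟩⟩ }

instance IsCosliceEquivalence.reflectsIsomorphisms {J I : Type*} [Category* J] [Category* I]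
    (φ : J ⥤ I) [IsCosliceEquivalence φ] : φ.ReflectsIsomorphisms where
  reflects {j k} f hf := by
    let g : Under.mk (𝟙 j) ⟶ Under.mk f := Under.homMk f
    have : IsIso ((Under.forget _).map ((Under.post φ).map g)) := hf
    have : IsIso ((Under.post φ).map g) := isIso_of_reflects_iso _ (Under.forget _)
    have : IsIso g := isIso_of_reflects_iso g (Under.post φ)
    exact inferInstanceAs (IsIso ((Under.forget _).map g))

variable {J I : Type w} [SmallCategory J] [SmallCategory I] [IsInverseCategory J]
  [IsInverseCategory I] (φ : J ⥤ I) [IsCosliceEquivalence φ]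

/-- The functor `∂(j/J) ⥤ ∂(φ(j)/I)` induced by `φ : J ⥤ I`. -/
def Boundary.map (j : J) : Boundary j ⥤ Boundary (φ.obj j) :=
  ObjectProperty.lift _ (ObjectProperty.ι _ ⋙ Under.post φ) fun f => by
    have := f.property
    rw [ne_eq, IsInverseCategory.eq_mk_id_iff_isIso] at this ⊢
    exact (isIso_iff_of_reflects_iso f.obj.hom φ).not.mpr this

instance (j : J) : (Boundary.map φ j).IsEquivalence where
  faithful := by unfold Boundary.map; infer_instance
  full := by unfold Boundary.map; infer_instance
  essSurj := ⟨fun f => by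
    let e := (Under.post φ).objObjPreimageIso f.obj
    refine ⟨⟨(Under.post φ).objPreimage f.obj, ?_⟩, ⟨ObjectProperty.isoMk _ e⟩⟩
    have hf := f.property
    rw [ne_eq, IsInverseCategory.eq_mk_id_iff_isIso] at hf ⊢
    refine fun h => hf ?_
    rw [← Under.w e.hom]
    exact IsIso.comp_isIso' (inferInstanceAs (IsIso (φ.map _)))
      (inferInstanceAs (IsIso ((Under.forget _).map e.hom)))⟩

end CosliceEquivalence

section Reindexing

variable {C : Type u} [Category.{v} C] [HasFiniteLimits C] {I : Type w} [SmallCategory I]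
  [FinCategory I]

theorem matchingObj_hom_ext {X : I ⥤ C} {i : I} {Z : C} {f g : Z ⟶ matchingObj X i}
    (h : ∀ k, f ≫ matchingObjProj X i k = g ≫ matchingObjProj X i k) : f = g :=
  limit.hom_ext h

variable {J : Type w} [SmallCategory J] [FinCategory J] [IsInverseCategory J]
  [IsInverseCategory I] (φ : J ⥤ I) [IsCosliceEquivalence φ]

/-- The identification `M_{φ(j)} X ≅ M_j (φ ⋙ X)` for a coslice equivalence `φ`. -/
noncomputable def matchingObjIso (X : I ⥤ C) (j : J) :
    matchingObj X (φ.obj j) ≅ matchingObj (φ ⋙ X) j :=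
  (Functor.Initial.limitIso (Boundary.map φ j) (Boundary.proj (φ.obj j) ⋙ X)).symm

theorem matchingObjIso_hom_proj (X : I ⥤ C) (j : J) (f : Boundary j) :
    (matchingObjIso φ X j).hom ≫ matchingObjProj (φ ⋙ X) j f =
      matchingObjProj X (φ.obj j) ((Boundary.map φ j).obj f) :=
  limit.pre_π (Boundary.proj (φ.obj j) ⋙ X) (Boundary.map φ j) f

theorem matchingMap_comp_matchingObjIso_hom (X : I ⥤ C) (j : J) :
    matchingMap X (φ.obj j) ≫ (matchingObjIso φ X j).hom = matchingMap (φ ⋙ X) j := by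
  refine matchingObj_hom_ext fun f => ?_
  rw [Category.assoc, matchingObjIso_hom_proj, matchingMap_proj]
  exact matchingMap_proj X (φ.obj j) ((Boundary.map φ j).obj f)

theorem matchingObjMap_comp_matchingObjIso_hom {X Y : I ⥤ C} (p : X ⟶ Y) (j : J) :
    matchingObjMap p (φ.obj j) ≫ (matchingObjIso φ Y j).hom =
      (matchingObjIso φ X j).hom ≫ matchingObjMap (Functor.whiskerLeft φ p) j := by
  refine matchingObj_hom_ext fun f => ?_
  rw [Category.assoc, Category.assoc, matchingObjIso_hom_proj, matchingObjMap_proj,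
    ← Category.assoc (matchingObjIso φ X j).hom, matchingObjIso_hom_proj]
  exact matchingObjMap_proj p (φ.obj j) ((Boundary.map φ j).obj f)

variable {F : MorphismProperty C} [F.RespectsIso]

theorem relativeMatchingMap_whiskerLeft_mem_iff {E B : I ⥤ C} (p : E ⟶ B) (j : J) :
    F (relativeMatchingMap (Functor.whiskerLeft φ p) j) ↔
      F (relativeMatchingMap p (φ.obj j)) := by
  have sq : IsPullback (pullback.fst (matchingMap B (φ.obj j)) (matchingObjMap p (φ.obj j)))
      (pullback.snd _ _ ≫ (matchingObjIso φ E j).hom) (matchingMap (φ ⋙ B) j)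
      (matchingObjMap (Functor.whiskerLeft φ p) j) :=
    (IsPullback.of_hasPullback _ _).of_iso (Iso.refl _) (Iso.refl _) (matchingObjIso φ E j)
      (matchingObjIso φ B j) (by simp) (by simp)
      (by simpa using matchingMap_comp_matchingObjIso_hom φ B j)
      (matchingObjMap_comp_matchingObjIso_hom φ p j)
  refine pullbackLift_mem_iff F sq _ _ ?_ ?_
  · exact pullback.lift_fst _ _ _
  · rw [← matchingMap_comp_matchingObjIso_hom, relativeMatchingMap, pullback.lift_snd_assoc]

theorem reedyFibrations_whiskerLeft {E B : I ⥤ C} {p : E ⟶ B} (hp : reedyFibrations F p) :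
    reedyFibrations F (Functor.whiskerLeft φ p) :=
  fun j => (relativeMatchingMap_whiskerLeft_mem_iff φ p j).mpr (hp (φ.obj j))

end Reindexing

section Complement

variable {I : Type w} [SmallCategory I]

/-- A map `i ⟶ j` with `j ≠ i` as an object of `∂(i/I)`. -/
def Boundary.mk {i j : I} (f : i ⟶ j) (hj : j ≠ i) : Boundary i :=
  ⟨Under.mk f, fun h => hj congr(Comma.right $h)⟩

variable [IsInverseCategory I]

theorem Boundary.right_ne {i : I} (f : Boundary i) : f.obj.right ≠ i := fun h => by
  obtain ⟨_, hf⟩ := IsInverseCategory.exists_eqToHom_of_hom_of_hom f.obj.hom (eqToHom h)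
  exact f.property ((IsInverseCategory.eq_mk_id_iff_isIso _).mpr (hf ▸ inferInstance))

/-- The projection `∂(i/I) ⥤ I`, corestricted to the objects other than `i`. -/
def Boundary.toComplement (i : I) : Boundary i ⥤ Complement i :=
  ObjectProperty.lift _ (Boundary.proj i) Boundary.right_ne

instance (i : I) : (Boundary.toComplement i).Faithful where
  map_injective h := ObjectProperty.hom_ext _ (Under.UnderMorphism.ext congr($(h).hom))

instance (i : I) : IsCosliceEquivalence (Boundary.toComplement i) where
  isEquivalence_post f :=
    { full := ⟨fun {g g'} m => by
        have hm : g.hom.hom.right ≫ m.right.hom = g'.hom.hom.right := congr($(Under.w m).hom)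
        refine ⟨Under.homMk (ObjectProperty.homMk (Under.homMk m.right.hom ?_)) ?_, rfl⟩
        · rw [← Under.w g.hom.hom, ← Under.w g'.hom.hom, ← hm]
          exact Category.assoc _ _ _
        · exact ObjectProperty.hom_ext _ (Under.UnderMorphism.ext hm)⟩
      essSurj := ⟨fun g => by
        let g' : Boundary i := Boundary.mk (f.obj.hom ≫ g.hom.hom) g.right.property
        exact ⟨Under.mk (ObjectProperty.homMk (Under.homMk g.hom.hom) : f ⟶ g'),
          ⟨Under.isoMk (Iso.refl _) (Category.comp_id _)⟩⟩⟩ }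

end Complement

section Extension

variable {I : Type*} [Category* I] {C : Type*} [Category* C]

theorem IsMaximal.exists_natTrans {i : I} (hi : IsMaximal i) {X Y : I ⥤ C}
    (a : X.obj i ⟶ Y.obj i) (β : Complement.ι i ⋙ X ⟶ Complement.ι i ⋙ Y)
    (h : ∀ (k : Complement i) (f : i ⟶ k.obj), X.map f ≫ β.app k = a ≫ Y.map f) :
    ∃ α : X ⟶ Y, α.app i = a ∧ Functor.whiskerLeft (Complement.ι i) α = β := by
  classical
  let α (j : I) : X.obj j ⟶ Y.obj j :=
    if hj : j = i then eqToHom (by rw [hj]) ≫ a ≫ eqToHom (by rw [hj]) else β.app ⟨j, hj⟩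
  have hαi : α i = a := by simp [α]
  have hα (j : I) (hj : j ≠ i) : α j = β.app ⟨j, hj⟩ := dif_neg hj
  refine ⟨{ app := α, naturality := fun j k f => ?_ }, hαi, ?_⟩
  · by_cases hk : k = i
    · subst hk
      obtain ⟨rfl, rfl⟩ := hi f
      simp
    rw [hα k hk]
    by_cases hj : j = i
    · subst hj
      rw [hαi]
      exact h ⟨k, hk⟩ f
    · rw [hα j hj]
      exact β.naturality (ObjectProperty.homMk f : (⟨j, hj⟩ : Complement i) ⟶ ⟨k, hk⟩)
  · ext j
    exact hα j.obj j.property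

theorem Complement.natTrans_ext {i : I} {X Y : I ⥤ C} {α β : X ⟶ Y}
    (hi : α.app i = β.app i)
    (h : Functor.whiskerLeft (Complement.ι i) α = Functor.whiskerLeft (Complement.ι i) β) :
    α = β := by
  ext j
  by_cases hj : j = i
  · exact hj ▸ hi
  · exact NatTrans.congr_app h ⟨j, hj⟩

variable {X : I ⥤ C} [HasLimit X] {Z : C}

theorem IsMaximal.exists_lift_limit {i : I} (hi : IsMaximal i)
    [HasLimit (Complement.ι i ⋙ X)] (a : Z ⟶ X.obj i)
    (b : Z ⟶ limit (Complement.ι i ⋙ X))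
    (h : ∀ (k : Complement i) (f : i ⟶ k.obj), b ≫ limit.π _ k = a ≫ X.map f) :
    ∃ l : Z ⟶ limit X, l ≫ limit.π X i = a ∧ l ≫ limit.pre X (Complement.ι i) = b := by
  let β : Complement.ι i ⋙ (Functor.const I).obj Z ⟶ Complement.ι i ⋙ X :=
    { app := fun k => b ≫ limit.π _ k
      naturality := fun k l f => by
        rw [Category.assoc, limit.w]
        exact Category.id_comp _ }
  obtain ⟨α, hα, hαι⟩ := hi.exists_natTrans a β fun k f => (Category.id_comp _).trans (h k f)
  refine ⟨limit.lift X ⟨Z, α⟩, (limit.lift_π _ _).trans hα, limit.hom_ext fun k => ?_⟩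
  rw [limit.lift_pre, limit.lift_π]
  exact NatTrans.congr_app hαι k

theorem Complement.limit_hom_ext {i : I} [HasLimit (Complement.ι i ⋙ X)] {a b : Z ⟶ limit X}
    (hi : a ≫ limit.π X i = b ≫ limit.π X i)
    (h : a ≫ limit.pre X (Complement.ι i) = b ≫ limit.pre X (Complement.ι i)) : a = b := by
  refine limit.hom_ext fun j => ?_
  by_cases hj : j = i
  · exact hj ▸ hi
  · have hπ := congr($h ≫ limit.π _ ⟨j, hj⟩)
    rw [Category.assoc, Category.assoc, limit.pre_π] at hπ
    exact hπ

end Extension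

section ToGluing

variable {I : Type w} [SmallCategory I] [FinCategory I] [IsInverseCategory I]
  {C : Type u} [Category.{v} C] [HasFiniteLimits C]

variable (C) in
/-- The functor sending a diagram on the complement of `i` to its limit over `∂(i/I)`. -/
noncomputable def boundaryLim (i : I) : (Complement i ⥤ C) ⥤ C :=
  (Functor.whiskeringLeft _ _ C).obj (Boundary.toComplement i) ⋙ lim

instance (i : I) : PreservesLimitsOfShape WalkingCospan (boundaryLim C i) := by
  unfold boundaryLim
  infer_instance

/-- The projection of `boundaryLim C i` onto the component at `f : i ⟶ k` in `∂(i/I)`. -/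
noncomputable def boundaryLimProj {i : I} (W : Complement i ⥤ C) {k : Complement i}
    (f : i ⟶ k.obj) : (boundaryLim C i).obj W ⟶ W.obj k :=
  limit.π (Boundary.toComplement i ⋙ W) (Boundary.mk f k.property)

theorem boundaryLim_hom_ext {i : I} {W : Complement i ⥤ C} {Z : C}
    {a b : Z ⟶ (boundaryLim C i).obj W}
    (h : ∀ (k : Complement i) (f : i ⟶ k.obj),
      a ≫ boundaryLimProj W f = b ≫ boundaryLimProj W f) : a = b :=
  limit.hom_ext fun f => h ⟨_, f.right_ne⟩ f.obj.hom

theorem boundaryLim_map_proj {i : I} {W W' : Complement i ⥤ C} (p : W ⟶ W') {k : Complement i}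
    (f : i ⟶ k.obj) :
    (boundaryLim C i).map p ≫ boundaryLimProj W' f = boundaryLimProj W f ≫ p.app k :=
  limMap_π (Functor.whiskerLeft (Boundary.toComplement i) p) _

theorem boundaryLimProj_comp_map {i : I} (W : Complement i ⥤ C) {k l : Complement i}
    (f : i ⟶ k.obj) (g : k ⟶ l) :
    boundaryLimProj W f ≫ W.map g = boundaryLimProj W (f ≫ g.hom) :=
  limit.w (Boundary.toComplement i ⋙ W) (ObjectProperty.homMk (Under.homMk g.hom) :
    Boundary.mk f k.property ⟶ Boundary.mk (f ≫ g.hom) l.property)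

/-- The comparison map from the limit of `W` to its limit over `∂(i/I)`. -/
noncomputable def limitToBoundaryLim {i : I} (W : Complement i ⥤ C) :
    limit W ⟶ (boundaryLim C i).obj W :=
  limit.pre W (Boundary.toComplement i)

theorem limitToBoundaryLim_proj {i : I} (W : Complement i ⥤ C) {k : Complement i}
    (f : i ⟶ k.obj) : limitToBoundaryLim W ≫ boundaryLimProj W f = limit.π W k :=
  limit.pre_π W (Boundary.toComplement i) _

/-- The matching map `m_i X`, with the matching object viewed as a limit of the restriction of `X`
to the complement of `i`. -/
noncomputable def boundaryMap (X : I ⥤ C) (i : I) :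
    X.obj i ⟶ (boundaryLim C i).obj (Complement.ι i ⋙ X) :=
  matchingMap X i

theorem boundaryMap_proj (X : I ⥤ C) {i : I} {k : Complement i} (f : i ⟶ k.obj) :
    boundaryMap X i ≫ boundaryLimProj (Complement.ι i ⋙ X) f = X.map f :=
  matchingMap_proj X i _

variable (C) in
/-- The functor splitting a diagram `X` into its matching map at `i` and its restriction to the
complement of `i`. -/
noncomputable def toGluing (i : I) : (I ⥤ C) ⥤ Comma (𝟭 C) (boundaryLim C i) where
  obj X := { left := X.obj i, right := Complement.ι i ⋙ X, hom := boundaryMap X i }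
  map p :=
    { left := p.app i
      right := Functor.whiskerLeft (Complement.ι i) p
      w := matchingMap_naturality p i }

variable (F : MorphismProperty C)

instance [F.RespectsIso] : (reedyFibrations F : MorphismProperty (I ⥤ C)).RespectsIso :=
  .mk _ (fun e f hf i => (((gapFibrations F).inverseImage
      (toGluing C i)).cancel_left_of_respectsIso e.hom f).mpr (hf i))
    (fun e f hf i => (((gapFibrations F).inverseImage
      (toGluing C i)).cancel_right_of_respectsIso f e.hom).mpr (hf i))

theorem IsMaximal.reedyFibrations_eq_inverseImage_gluedFibrations [F.RespectsIso] {i : I}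
    (hi : IsMaximal i) : (reedyFibrations F : MorphismProperty (I ⥤ C)) =
      (gluedFibrations F (reedyFibrations F)).inverseImage (toGluing C i) := by
  have := hi.isCosliceEquivalence_ι
  ext E B p
  refine ⟨fun hp => ⟨reedyFibrations_whiskerLeft _ hp, hp i⟩, fun ⟨hp, hpi⟩ j => ?_⟩
  by_cases hj : j = i
  · exact hj ▸ hpi
  · exact (relativeMatchingMap_whiskerLeft_mem_iff (Complement.ι i) p ⟨j, hj⟩).mp (hp ⟨j, hj⟩)

instance (i : I) : (toGluing C i).Faithful where
  map_injective h :=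
    Complement.natTrans_ext congr(CommaMorphism.left $h) congr(CommaMorphism.right $h)

theorem IsMaximal.toGluing_full {i : I} (hi : IsMaximal i) : (toGluing C i).Full where
  map_surjective {X Y} m := by
    obtain ⟨α, hα, hαι⟩ := hi.exists_natTrans m.left m.right fun k f => by
      have hm := congr($(m.w) ≫ boundaryLimProj _ f)
      rw [Category.assoc, Category.assoc, boundaryLim_map_proj] at hm
      rw [← boundaryMap_proj X f, ← boundaryMap_proj Y f]
      exact (Category.assoc _ _ _).trans hm.symm
    exact ⟨α, Comma.hom_ext _ _ hα hαι⟩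

end ToGluing

section Glue

variable {I : Type w} [SmallCategory I] [FinCategory I] [IsInverseCategory I]
  {C : Type u} [Category.{v} C] [HasFiniteLimits C] {i : I} (G : Comma (𝟭 C) (boundaryLim C i))

/-- The value at `j` of the diagram glued from `G`. Since `j = i` is an argument rather than
decided inside the definition, the cases of this and the next definitions reduce. -/
def glueObj (j : I) : Decidable (j = i) → C
  | isTrue _ => G.left
  | isFalse h => G.right.obj ⟨j, h⟩

variable {G}

/-- The value at `f : j ⟶ k` of the diagram glued from `G`. -/
noncomputable def IsMaximal.glueMap (hi : IsMaximal i) {j k : I} (f : j ⟶ k) :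
    ∀ (dj : Decidable (j = i)) (dk : Decidable (k = i)), glueObj G j dj ⟶ glueObj G k dk
  | isTrue _, isTrue _ => 𝟙 G.left
  | isTrue hj, isFalse hk => G.hom ≫ boundaryLimProj G.right (k := ⟨k, hk⟩) (eqToHom hj.symm ≫ f)
  | isFalse hj, isTrue hk => (hj (hi.eq (f ≫ eqToHom hk))).elim
  | isFalse hj, isFalse hk => G.right.map (ObjectProperty.homMk f : ⟨j, hj⟩ ⟶ ⟨k, hk⟩)

theorem IsMaximal.glueMap_id (hi : IsMaximal i) (j : I) (dj : Decidable (j = i)) :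
    hi.glueMap (𝟙 j) dj dj = 𝟙 (glueObj G j dj) :=
  match dj with
  | isTrue _ => rfl
  | isFalse h => G.right.map_id ⟨j, h⟩

theorem IsMaximal.glueMap_comp (hi : IsMaximal i) {j k l : I} (f : j ⟶ k) (g : k ⟶ l)
    (dj : Decidable (j = i)) (dk : Decidable (k = i)) (dl : Decidable (l = i)) :
    hi.glueMap (G := G) (f ≫ g) dj dl = hi.glueMap f dj dk ≫ hi.glueMap g dk dl :=
  match dj, dk, dl with
  | isTrue _, isTrue _, isTrue _ => (Category.id_comp _).symm
  | isTrue hj, isTrue hk, isFalse hl => by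
      subst hk
      obtain ⟨rfl, rfl⟩ := hi f
      have h := congr(G.hom ≫ boundaryLimProj (k := ⟨l, hl⟩) G.right
        (𝟙 _ ≫ $(Category.id_comp g)))
      exact h.trans (Category.id_comp _).symm
  | isTrue _, isFalse hk, isTrue hl => (hk (hi.eq (g ≫ eqToHom hl))).elim
  | isTrue hj, isFalse hk, isFalse hl => by
      have h := boundaryLimProj_comp_map G.right (k := ⟨k, hk⟩) (l := ⟨l, hl⟩)
        (eqToHom hj.symm ≫ f) (ObjectProperty.homMk g)
      rw [Category.assoc] at h
      exact (congr(G.hom ≫ $h)).symm.trans (Category.assoc _ _ _).symm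
  | isFalse hj, isTrue hk, _ => (hj (hi.eq (f ≫ eqToHom hk))).elim
  | isFalse hj, _, isTrue hl => (hj (hi.eq ((f ≫ g) ≫ eqToHom hl))).elim
  | isFalse hj, isFalse hk, isFalse hl =>
      G.right.map_comp (X := ⟨j, hj⟩) (Y := ⟨k, hk⟩) (Z := ⟨l, hl⟩) (ObjectProperty.homMk f)
        (ObjectProperty.homMk g)

variable (G) in
open scoped Classical in
/-- The diagram glued from a diagram `G.right` on the complement of a maximal object `i` and a
map `G.hom` from a new value at `i` to the limit of `G.right` over `∂(i/I)`. -/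
noncomputable def IsMaximal.glue (hi : IsMaximal i) : I ⥤ C where
  obj j := glueObj G j inferInstance
  map f := hi.glueMap f _ _
  map_id j := hi.glueMap_id j _
  map_comp f g := hi.glueMap_comp f g _ _ _

/-- The value at `i` of the diagram glued from `G` is `G.left`. -/
def glueObjIsoLeft : ∀ d : Decidable (i = i), glueObj G i d ≅ G.left
  | isTrue _ => Iso.refl _
  | isFalse h => (h rfl).elim

/-- The value at `k ≠ i` of the diagram glued from `G` is `G.right.obj k`. -/
def glueObjIsoRight (k : Complement i) :
    ∀ d : Decidable (k.obj = i), glueObj G k.obj d ≅ G.right.obj k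
  | isTrue h => (k.property h).elim
  | isFalse _ => Iso.refl _

theorem IsMaximal.glueMap_comp_glueObjIsoRight_hom (hi : IsMaximal i) {k l : Complement i}
    (f : k ⟶ l) (dk : Decidable (k.obj = i)) (dl : Decidable (l.obj = i)) :
    hi.glueMap f.hom dk dl ≫ (glueObjIsoRight l dl).hom =
      (glueObjIsoRight k dk).hom ≫ G.right.map f :=
  match dk, dl with
  | isTrue h, _ => (k.property h).elim
  | _, isTrue h => (l.property h).elim
  | isFalse _, isFalse _ => (Category.comp_id _).trans (Category.id_comp _).symm

theorem IsMaximal.glueMap_comp_glueObjIsoRight_hom_of_left (hi : IsMaximal i) {k : Complement i}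
    (f : i ⟶ k.obj) (di : Decidable (i = i)) (dk : Decidable (k.obj = i)) :
    hi.glueMap f di dk ≫ (glueObjIsoRight k dk).hom =
      (glueObjIsoLeft di).hom ≫ G.hom ≫ boundaryLimProj G.right f :=
  match di, dk with
  | isFalse h, _ => (h rfl).elim
  | _, isTrue h => (k.property h).elim
  | isTrue _, isFalse _ => by
      rw [glueMap, eqToHom_refl, Category.id_comp]
      exact (Category.comp_id _).trans (Category.id_comp _).symm

theorem IsMaximal.toGluing_essSurj (hi : IsMaximal i) : (toGluing C i).EssSurj where
  mem_essImage G := by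
    let r : Complement.ι i ⋙ hi.glue G ≅ G.right := NatIso.ofComponents
      (fun k => glueObjIsoRight k _) fun f => hi.glueMap_comp_glueObjIsoRight_hom f _ _
    refine ⟨hi.glue G, ⟨Comma.isoMk (glueObjIsoLeft _) r
      (boundaryLim_hom_ext fun k f => ?_)⟩⟩
    rw [Category.assoc, Category.assoc, boundaryLim_map_proj]
    exact (hi.glueMap_comp_glueObjIsoRight_hom_of_left f _ _).symm.trans
      (congr($((boundaryMap_proj (hi.glue G) f).symm) ≫ r.hom.app k).trans
        (Category.assoc _ _ _))

theorem IsMaximal.toGluing_isEquivalence (hi : IsMaximal i) : (toGluing C i).IsEquivalence where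
  full := hi.toGluing_full
  essSurj := hi.toGluing_essSurj

end Glue

section Limits

variable {I : Type w} [SmallCategory I] [FinCategory I] [IsInverseCategory I]
  {C : Type u} [Category.{v} C] [HasFiniteLimits C]

theorem IsMaximal.isPullback_limit {i : I} (hi : IsMaximal i) (X : I ⥤ C) :
    IsPullback (limit.π X i) (limit.pre X (Complement.ι i)) (boundaryMap X i)
      (limitToBoundaryLim (Complement.ι i ⋙ X)) := by
  have w : limit.π X i ≫ boundaryMap X i =
      limit.pre X (Complement.ι i) ≫ limitToBoundaryLim (Complement.ι i ⋙ X) := by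
    refine boundaryLim_hom_ext fun k f => ?_
    rw [Category.assoc, Category.assoc, limitToBoundaryLim_proj, boundaryMap_proj, limit.pre_π]
    exact limit.w X f
  refine ⟨⟨w⟩, ⟨PullbackCone.isLimitAux' _ fun s => ?_⟩⟩
  have hs (k : Complement i) (f : i ⟶ k.obj) : s.snd ≫ limit.π _ k = s.fst ≫ X.map f := by
    rw [← boundaryMap_proj, reassoc_of% s.condition, limitToBoundaryLim_proj]
  have hl := hi.exists_lift_limit s.fst s.snd hs
  refine ⟨hl.choose, hl.choose_spec.1, hl.choose_spec.2, fun {m} hm₁ hm₂ => ?_⟩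
  refine Complement.limit_hom_ext (i := i) (hm₁.trans hl.choose_spec.1.symm) ?_
  exact hm₂.trans hl.choose_spec.2.symm

theorem limMap_mem_of_reedyFibrations {F : MorphismProperty C} [F.IsMultiplicative]
    [F.IsStableUnderBaseChange] {X Y : I ⥤ C} (p : X ⟶ Y) (hp : reedyFibrations F p) :
    F (limMap p) := by
  refine IsInverseCategory.induction (motive := fun I _ _ _ =>
    ∀ {X Y : I ⥤ C} (p : X ⟶ Y), reedyFibrations F p → F (limMap p)) ?_ ?_ I p hp
  · intro I _ _ _ _ X Y p _
    have : IsIso p := (NatTrans.isIso_iff_isIso_app p).mpr isEmptyElim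
    exact F.of_isIso (lim.map p)
  · intro I _ _ _ i hi ih X Y p hp
    rw [hi.reedyFibrations_eq_inverseImage_gluedFibrations (F := F)] at hp
    refine mem_of_isPullback_of_pullbackLift_mem F (hi.isPullback_limit X) (hi.isPullback_limit Y)
      (p₁ := p.app i) (p₀ := limMap (Functor.whiskerLeft (Complement.ι i) p))
      ?_ ?_ ?_ hp.2 (ih _ hp.1)
    · simp
    · exact limit.map_pre ..
    · exact limit.map_pre ..

theorem reedyFibrations_le_inverseImage_boundaryLim {F : MorphismProperty C} [F.IsMultiplicative]
    [F.IsStableUnderBaseChange] (i : I) :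
    (reedyFibrations F : MorphismProperty (Complement i ⥤ C)) ≤
      F.inverseImage (boundaryLim C i) :=
  fun _ _ _ hp => limMap_mem_of_reedyFibrations _
    (reedyFibrations_whiskerLeft (Boundary.toComplement i) hp)

end Limits

section Induction

variable {C : Type u} [Category.{v} C] [HasFiniteLimits C]
  {I : Type w} [SmallCategory I] [FinCategory I]
  {F : MorphismProperty C} [F.RespectsIso]

theorem stableUnderPushforward_reedyFibrations_of_isEmpty [IsInverseCategory I] [IsEmpty I] :
    StableUnderPushforward (reedyFibrations F : MorphismProperty (I ⥤ C)) := by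
  rw [stableUnderPushforward_iff_exists_isDistributivityPullback]
  intro A B K p k _ _
  have : IsIso p := (NatTrans.isIso_iff_isIso_app p).mpr isEmptyElim
  exact ⟨K, K, 𝟙 K, 𝟙 K, k ≫ p, isEmptyElim, .of_isIso p k⟩

end Induction

end InverseDiagrams

theorem mainTheorem2 {C : Type u} [Category.{v} C] [HasFiniteLimits C]
    {I : Type w} [SmallCategory I] [FinCategory I] [InverseDiagrams.IsInverseCategory I]
    (F : MorphismProperty C) [F.IsMultiplicative] [F.IsStableUnderBaseChange]
    (hF : InverseDiagrams.StableUnderPushforward F) :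
    InverseDiagrams.StableUnderPushforward
      (InverseDiagrams.reedyFibrations F : MorphismProperty (I ⥤ C)) := by
  refine InverseDiagrams.IsInverseCategory.induction (motive := fun I _ _ _ =>
    InverseDiagrams.StableUnderPushforward
      (InverseDiagrams.reedyFibrations F : MorphismProperty (I ⥤ C))) ?_ ?_ I
  · intro I _ _ _ _
    exact InverseDiagrams.stableUnderPushforward_reedyFibrations_of_isEmpty
  · intro I _ _ _ i hi ih
    have := hi.toGluing_isEquivalence (C := C)
    rw [hi.reedyFibrations_eq_inverseImage_gluedFibrations (F := F)]
    exact (hF.gluedFibrations ih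
      (InverseDiagrams.reedyFibrations_le_inverseImage_boundaryLim i)).inverseImage _
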